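/- Let $A$ be a self-adjoint (in general unbounded) operator with domain $D(A)$ on the complex Hilbert space $L^2(\mathbb{R}^n)$. Suppose that $A$ is locally compact: for each bounded (measurable) set $B\subset\mathbb{R}^n$ with characteristic function $\chi_B$, the operator $\chi_B(A-\lambda)^{-1}$ is compact for some $\lambda$ in the resolvent set of $A$. Let $\phi\in C_0^\infty(\mathbb{R}^n)$ be real-valued with $\phi\ge 0$, $\operatorname{supp}\phi\subset B(0,2)$ and $\phi=1$ on $B(0,1)$, where $B(0,R)$ is the ball of radius $R$ centred at $0$; put $\phi_k(x)=\phi(x/k)$, and denote by $\phi_k$ also the operator of multiplication by this function. Suppose that, with $[A,\phi_k]=A\phi_k-\phi_kA$ on its natural domain $\{u\in D(A):\phi_k u\in D(A)\}$, the operator $[A,\phi_k](A-i)^{-1}$ is densely defined for all large $k$ and $$\bigl\|[A,\phi_k](A-i)^{-1}\bigr\|\to 0\quad\text{as }k\to\infty .$$ Then $\sigma_{\mathrm{ess}}(A)=Z(A)$. Here $\sigma_{\mathrm{ess}}(A)=\sigma(A)\setminus\sigma_{\mathrm{disc}}(A)$, where $\sigma_{\mathrm{disc}}(A)$ is the set of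 all eigenvalues of $A$ of finite algebraic multiplicity that are isolated points of the spectrum $\sigma(A)$. The Zhislin spectrum $Z(A)$ is the set of all $\lambda\in\mathbb{C}$ for which there is a sequence $(u_k)_k$ in $D(A)$ with $\|u_k\|=1$, $\operatorname{supp}u_k\subset\mathbb{R}^n\setminus B_k$ for every $k$, where $B_k=\{x:\|x\|\le k\}$, and $\|(A-\lambda)u_k\|\to 0$ as $k\to\infty$. -/

import Mathlib

open MeasureTheory Filter Topology
open scoped ENNReal ContDiff

noncomputable section

namespace Zhislin

/-! ### Unbounded operators on a complex Hilbert space -/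

section Operators

variable {X : Type*} [NormedAddCommGroup X] [InnerProductSpace ℂ X]

/-- An everywhere defined bounded operator, seen as an operator with a domain. -/
def ofBounded (M : X →L[ℂ] X) : X →ₗ.[ℂ] X := (M : X →ₗ[ℂ] X).toPMap ⊤

/-- `A - z`, with the domain of `A`. -/
def shift (A : X →ₗ.[ℂ] X) (z : ℂ) : X →ₗ.[ℂ] X :=
  A - ofBounded (z • ContinuousLinearMap.id ℂ X)

/-- The product `T S` of two unbounded operators, with its natural domain
`{u ∈ D(S) | S u ∈ D(T)}`. -/
def prod (T S : X →ₗ.[ℂ] X) : X →ₗ.[ℂ] X :=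
  T.comp (S.domRestrict ((T.domain.comap S.toFun).map S.domain.subtype)) (by
    rintro ⟨x, hx⟩
    obtain ⟨y, hy, rfl⟩ := hx.1
    have h := LinearPMap.domRestrict_apply (f := S) (x := ⟨_, hx⟩) (y := y) rfl
    exact h ▸ hy)

/-- The commutator `[T, S] = T S - S T`, with its natural domain. -/
def commutator (T S : X →ₗ.[ℂ] X) : X →ₗ.[ℂ] X := prod T S - prod S T

/-- The operator norm of an operator with a domain, with value `∞` if the operator is not
bounded on its domain. -/
def opENorm (T : X →ₗ.[ℂ] X) : ℝ≥0∞ := ⨆ (v : T.domain) (_ : ‖(v : X)‖ ≤ 1), ‖T v‖ₑ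

/-- `R` is the resolvent of `A` at `z`: `A - z` is injective on `D(A)` and its inverse is the
everywhere defined bounded operator `R`. -/
def IsResolvent (A : X →ₗ.[ℂ] X) (z : ℂ) (R : X →L[ℂ] X) : Prop :=
  (shift A z).toFun.ker = ⊥ ∧ (shift A z).inverse = ofBounded R

/-- The resolvent set. -/
def resolventSet (A : X →ₗ.[ℂ] X) : Set ℂ := {z | ∃ R : X →L[ℂ] X, IsResolvent A z R}

/-- The spectrum. -/
def spectrum (A : X →ₗ.[ℂ] X) : Set ℂ := (resolventSet A)ᶜ

/-- `ker (A - z) ^ k`, with the natural domain of the power. -/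
def kerPow (A : X →ₗ.[ℂ] X) (z : ℂ) : ℕ → Submodule ℂ X
  | 0 => ⊥
  | k + 1 => ((kerPow A z k).comap (shift A z).toFun).map (shift A z).domain.subtype

/-- The algebraic eigenspace of `A` at `z`, the union of the increasing chain
`ker (A - z) ^ k`; its dimension is the algebraic multiplicity. -/
def algEigenspace (A : X →ₗ.[ℂ] X) (z : ℂ) : Submodule ℂ X := ⨆ k, kerPow A z k

/-- The discrete spectrum: the eigenvalues of finite algebraic multiplicity which are isolated
points of the spectrum. -/
def discreteSpectrum (A : X →ₗ.[ℂ] X) : Set ℂ :=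
  {z | z ∈ spectrum A ∧ (∃ u : A.domain, u ≠ 0 ∧ A u = z • (u : X)) ∧
    FiniteDimensional ℂ (algEigenspace A z) ∧ ∃ U ∈ 𝓝 z, U ∩ spectrum A = {z}}

/-- The essential spectrum: the complement of the discrete spectrum in the spectrum. -/
def essentialSpectrum (A : X →ₗ.[ℂ] X) : Set ℂ := spectrum A \ discreteSpectrum A

end Operators

/-! ### Operators on `L²(ℝᵈ)` -/

/-- The Hilbert space of complex-valued square-integrable functions on `ℝᵈ`. -/
abbrev L2 (d : ℕ) : Type := Lp ℂ 2 (volume : Measure (EuclideanSpace ℝ (Fin d)))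

/-- Multiplication by an essentially bounded function `g` on `L²(ℝᵈ)`. -/
def mulOp {d : ℕ} (g : EuclideanSpace ℝ (Fin d) → ℂ) (hg : MemLp g ∞ volume) :
    L2 d →L[ℂ] L2 d :=
  (ContinuousLinearMap.mul ℂ ℂ).holderL volume ∞ 2 2 (hg.toLp g)

theorem mulOp_apply {d : ℕ} (g : EuclideanSpace ℝ (Fin d) → ℂ) (hg : MemLp g ∞ volume)
    (u : L2 d) : mulOp g hg u =ᵐ[volume] fun x => g x * u x := by
  have h := ContinuousLinearMap.coeFn_holder (r := 2) (ContinuousLinearMap.mul ℂ ℂ)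
    (hg.toLp g) u
  filter_upwards [h, hg.coeFn_toLp] with x hx hx'
  rw [hx'] at hx
  exact hx

theorem memLp_indicator {d : ℕ} {B : Set (EuclideanSpace ℝ (Fin d))} (hB : MeasurableSet B) :
    MemLp (B.indicator fun _ => (1 : ℂ)) ∞ volume :=
  (memLp_top_const 1).indicator hB

/-- `A` is locally compact: for each bounded (measurable) set `B`, the operator
`χ_B (A - z)⁻¹` is compact for some `z` in the resolvent set of `A`. -/
def IsLocallyCompact {d : ℕ} (A : L2 d →ₗ.[ℂ] L2 d) : Prop :=
  ∀ (B : Set (EuclideanSpace ℝ (Fin d))) (hB : MeasurableSet B), Bornology.IsBounded B →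
    ∃ (z : ℂ) (R : L2 d →L[ℂ] L2 d), IsResolvent A z R ∧
      IsCompactOperator (mulOp (B.indicator fun _ => (1 : ℂ)) (memLp_indicator hB) ∘L R)

/-- The support of a function in `L²(ℝᵈ)`: the complement of the largest open set on which it
vanishes almost everywhere. -/
def essSupport {d : ℕ} (u : L2 d) : Set (EuclideanSpace ℝ (Fin d)) :=
  {x | ∀ U ∈ 𝓝 x, ¬ ∀ᵐ y ∂(volume.restrict U), u y = 0}

/-- `u` is a Zhislin sequence for `A` and `z`. -/
structure IsZhislinSeq {d : ℕ} (A : L2 d →ₗ.[ℂ] L2 d) (z : ℂ) (u : ℕ → A.domain) : Prop where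
  norm_eq_one : ∀ k, ‖(u k : L2 d)‖ = 1
  support_subset : ∀ k : ℕ, essSupport (u k : L2 d) ⊆ (Metric.closedBall 0 (k : ℝ))ᶜ
  tendsto_zero : Tendsto (fun k => ‖A (u k) - z • (u k : L2 d)‖) atTop (𝓝 0)

/-- The Zhislin spectrum `Z(A)`. -/
def zhislinSpectrum {d : ℕ} (A : L2 d →ₗ.[ℂ] L2 d) : Set ℂ :=
  {z | ∃ u : ℕ → A.domain, IsZhislinSeq A z u}

/-- A nonnegative `φ` in `C_0^∞(ℝᵈ)`, supported in the ball of radius `2` and equal to `1` on the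
ball of radius `1`. -/
structure IsCutoff {d : ℕ} (φ : EuclideanSpace ℝ (Fin d) → ℝ) : Prop where
  contDiff : ContDiff ℝ ∞ φ
  hasCompactSupport : HasCompactSupport φ
  tsupport_subset : tsupport φ ⊆ Metric.closedBall 0 2
  nonneg : ∀ x, 0 ≤ φ x
  eq_one : ∀ x ∈ Metric.ball (0 : EuclideanSpace ℝ (Fin d)) 1, φ x = 1

theorem IsCutoff.memLp {d : ℕ} {φ : EuclideanSpace ℝ (Fin d) → ℝ} (hφ : IsCutoff φ) (n : ℕ) :
    MemLp (fun x => ((φ ((n : ℝ)⁻¹ • x) : ℝ) : ℂ)) ∞ volume := by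
  obtain ⟨C, hC⟩ := hφ.hasCompactSupport.exists_bound_of_continuous hφ.contDiff.continuous
  have hc : Continuous φ := hφ.contDiff.continuous
  refine memLp_top_of_bound (C := C) ?_ (Eventually.of_forall fun x => ?_)
  · exact Continuous.aestronglyMeasurable (by fun_prop)
  · simpa using hC ((n : ℝ)⁻¹ • x)

/-- Multiplication by `φ_n(x) = φ(x / n)`, as an operator on `L²(ℝᵈ)`. -/
def cutoffOp {d : ℕ} {φ : EuclideanSpace ℝ (Fin d) → ℝ} (hφ : IsCutoff φ) (n : ℕ) :
    L2 d →ₗ.[ℂ] L2 d :=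
  ofBounded (mulOp (fun x => ((φ ((n : ℝ)⁻¹ • x) : ℝ) : ℂ)) (hφ.memLp n))

/-- The operator `[A, φ_n] (A - i)⁻¹`, with its natural domain. -/
def commutatorResolvent {d : ℕ} (A : L2 d →ₗ.[ℂ] L2 d) {φ : EuclideanSpace ℝ (Fin d) → ℝ}
    (hφ : IsCutoff φ) (n : ℕ) : L2 d →ₗ.[ℂ] L2 d :=
  prod (commutator A (cutoffOp hφ n)) (shift A Complex.I).inverse

end Zhislin

end

namespace Zhislin

/-! The inclusion `Z(A) ⊆ σ_ess(A)`: a Zhislin sequence consists of unit approximate eigenvectors,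
so `z` lies in the spectrum, and it is weakly null because its supports leave every bounded set. At
a discrete point, `A - z` is bounded below on the orthogonal complement of a finite-dimensional
eigenspace, so both components of the sequence would tend to zero in norm
(`not_tendsto_of_mem_discreteSpectrum`). The lower bound comes from the continuous functional
calculus of a resolvent.

The inclusion `σ_ess(A) ⊆ Z(A)`: off `Z(A)`, `A - z` is bounded below on functions supported far
out. Applying this to `(1 - φ_n) u`, with the commutator small, gives `‖u‖ ≤ 2 ‖φ_n u‖ + C ‖(A - z)
u‖` for one fixed `n`. Since `φ_n (A - i)⁻¹` is compact, bounded approximate eigenvectors have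
convergent subsequences, which forces a spectral point to be discrete (`mem_discreteSpectrum`).

Operators are handled through their graphs, which avoids arithmetic with domain subtypes. -/

theorem cauchySeq_of_norm_sub_le {E F : Type*} [SeminormedAddCommGroup E]
    [SeminormedAddCommGroup F] {x : ℕ → E} {w : ℕ → F} (hx : CauchySeq x) (K : ℝ)
    (h : ∀ j l, ‖w j - w l‖ ≤ K * ‖x j - x l‖) : CauchySeq w := by
  rw [Metric.cauchySeq_iff] at hx ⊢
  intro ε hε
  obtain ⟨N, hN⟩ := hx (ε / (|K| + 1)) (by positivity)
  refine ⟨N, fun m hm n hn => ?_⟩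
  have h₁ := hN m hm n hn
  rw [lt_div_iff₀ (by positivity), dist_eq_norm] at h₁
  rw [dist_eq_norm]
  have h₂ : K * ‖x m - x n‖ ≤ |K| * ‖x m - x n‖ := by gcongr; exact le_abs_self K
  nlinarith [h m n, norm_nonneg (x m - x n)]

/-! ### Graphs of shifts, products, commutators and resolvents. -/

section Graph

variable {X : Type*} [NormedAddCommGroup X] [InnerProductSpace ℂ X]

theorem mem_graph_ofBounded {M : X →L[ℂ] X} {u f : X} :
    (u, f) ∈ (ofBounded M).graph ↔ f = M u := by
  rw [LinearPMap.mem_graph_iff]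
  constructor
  · rintro ⟨y, rfl, h⟩
    exact h.symm
  · rintro rfl
    exact ⟨⟨u, Submodule.mem_top⟩, rfl, rfl⟩

theorem mem_graph_sub {S T : X →ₗ.[ℂ] X} {u f : X} :
    (u, f) ∈ (S - T).graph ↔ ∃ a b, (u, a) ∈ S.graph ∧ (u, b) ∈ T.graph ∧ f = a - b := by
  constructor
  · intro h
    obtain ⟨y, rfl, h⟩ := (LinearPMap.mem_graph_iff _).1 h
    exact ⟨S ⟨y, y.2.1⟩, T ⟨y, y.2.2⟩, S.mem_graph ⟨y, y.2.1⟩, T.mem_graph ⟨y, y.2.2⟩, h.symm⟩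
  · rintro ⟨a, b, ha, hb, rfl⟩
    obtain ⟨y, hy, rfl⟩ := (LinearPMap.mem_graph_iff _).1 ha
    obtain ⟨y', hy', rfl⟩ := (LinearPMap.mem_graph_iff _).1 hb
    obtain ⟨y, hm⟩ := y
    obtain ⟨y', hm'⟩ := y'
    dsimp only at hy hy'
    subst hy'
    subst hy
    exact (S - T).mem_graph ⟨_, hm, hm'⟩

theorem mem_graph_shift {A : X →ₗ.[ℂ] X} {z : ℂ} {u f : X} :
    (u, f) ∈ (shift A z).graph ↔ (u, f + z • u) ∈ A.graph := by
  rw [shift, mem_graph_sub]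
  constructor
  · rintro ⟨a, b, ha, hb, rfl⟩
    rw [mem_graph_ofBounded] at hb
    simpa [hb] using ha
  · intro h
    exact ⟨_, z • u, h, mem_graph_ofBounded.2 rfl, by simp⟩

theorem mem_graph_prod {S T : X →ₗ.[ℂ] X} {u f : X} :
    (u, f) ∈ (prod T S).graph ↔ ∃ v, (u, v) ∈ S.graph ∧ (v, f) ∈ T.graph := by
  constructor
  · intro h
    obtain ⟨y, rfl, h⟩ := (LinearPMap.mem_graph_iff _).1 h
    refine ⟨S ⟨y, y.2.2⟩, S.mem_graph ⟨y, y.2.2⟩, ?_⟩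
    obtain ⟨⟨x, hx, hxy⟩, hy⟩ := y.2
    have hm : S ⟨y, y.2.2⟩ ∈ T.domain := by
      have : x = ⟨y, y.2.2⟩ := Subtype.ext hxy
      exact this ▸ hx
    exact (LinearPMap.mem_graph_iff _).2 ⟨⟨_, hm⟩, rfl, h⟩
  · rintro ⟨v, hv, hf⟩
    obtain ⟨y, hy, rfl⟩ := (LinearPMap.mem_graph_iff _).1 hv
    obtain ⟨y', hy', rfl⟩ := (LinearPMap.mem_graph_iff _).1 hf
    obtain ⟨y, hm⟩ := y
    obtain ⟨y', hm'⟩ := y'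
    dsimp only at hy hy'
    subst hy hy'
    exact (prod T S).mem_graph ⟨y, ⟨⟨y, hm⟩, hm', rfl⟩, hm⟩

theorem mem_graph_commutator_ofBounded {A : X →ₗ.[ℂ] X} {M : X →L[ℂ] X} {u w : X} :
    (u, w) ∈ (commutator A (ofBounded M)).graph ↔
      ∃ f g, (u, f) ∈ A.graph ∧ (M u, g) ∈ A.graph ∧ w = g - M f := by
  simp only [commutator, mem_graph_sub, mem_graph_prod, mem_graph_ofBounded]
  constructor
  · rintro ⟨a, b, ⟨v, rfl, ha⟩, ⟨f, hf, rfl⟩, rfl⟩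
    exact ⟨f, a, hf, ha, rfl⟩
  · rintro ⟨f, g, hf, hg, rfl⟩
    exact ⟨g, M f, ⟨_, rfl, hg⟩, ⟨f, hf, rfl⟩, rfl⟩

theorem ker_shift_eq_bot_iff {A : X →ₗ.[ℂ] X} {z : ℂ} :
    (shift A z).toFun.ker = ⊥ ↔ ∀ u, (u, z • u) ∈ A.graph → u = 0 := by
  rw [LinearMap.ker_eq_bot']
  constructor
  · intro h u hu
    have hu' : (u, 0) ∈ (shift A z).graph := by rwa [mem_graph_shift, zero_add]
    obtain ⟨y, rfl, hy⟩ := (LinearPMap.mem_graph_iff _).1 hu'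
    rw [h y hy]
    rfl
  · intro h y hy
    have := (shift A z).mem_graph y
    rw [mem_graph_shift] at this
    have hy' : (shift A z) y = 0 := hy
    rw [hy', zero_add] at this
    exact Subtype.ext (h _ this)

/-- The graph description of the resolvent. -/
theorem isResolvent_iff {A : X →ₗ.[ℂ] X} {z : ℂ} {R : X →L[ℂ] X} :
    IsResolvent A z R ↔ (∀ v, (R v, v + z • R v) ∈ A.graph) ∧
      ∀ u f, (u, f) ∈ A.graph → R (f - z • u) = u := by
  have swap (hk : (shift A z).toFun.ker = ⊥) (v u : X) :
      (v, u) ∈ (shift A z).inverse.graph ↔ (u, v + z • u) ∈ A.graph := by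
    rw [LinearPMap.inverse_graph hk, ← mem_graph_shift]
    constructor
    · rintro ⟨⟨a, b⟩, h, hab⟩
      cases hab
      exact h
    · exact fun h => ⟨(u, v), h, rfl⟩
  constructor
  · rintro ⟨hk, h⟩
    have h' (v u : X) := swap hk v u
    rw [h] at h'
    simp only [mem_graph_ofBounded] at h'
    refine ⟨fun v => (h' v (R v)).1 rfl, fun u f hu => ((h' _ u).2 ?_).symm⟩
    simpa using hu
  · rintro ⟨h₁, h₂⟩
    have hk : (shift A z).toFun.ker = ⊥ := by
      refine ker_shift_eq_bot_iff.2 fun u hu => ?_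
      have := h₂ _ _ hu
      simpa using this.symm
    refine ⟨hk, LinearPMap.eq_of_eq_graph ?_⟩
    ext ⟨v, u⟩
    rw [swap hk, mem_graph_ofBounded]
    constructor
    · intro h
      simpa using (h₂ _ _ h).symm
    · rintro rfl
      exact h₁ v

theorem mem_graph_prod_inverse_shift {A T : X →ₗ.[ℂ] X} {z : ℂ} {R : X →L[ℂ] X}
    (hR : IsResolvent A z R) {v w : X} :
    (v, w) ∈ (prod T (shift A z).inverse).graph ↔ (R v, w) ∈ T.graph := by
  simp only [mem_graph_prod, hR.2, mem_graph_ofBounded, exists_eq_left]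

theorem norm_le_opENorm {T : X →ₗ.[ℂ] X} (hT : opENorm T ≠ ⊤) {v w : X}
    (h : (v, w) ∈ T.graph) : ‖w‖ ≤ (opENorm T).toReal * ‖v‖ := by
  rcases eq_or_ne v 0 with rfl | hv
  · rw [T.graph_fst_eq_zero_snd h rfl]
    simp
  have hn : ‖v‖ ≠ 0 := norm_ne_zero_iff.2 hv
  set c : ℂ := ((‖v‖⁻¹ : ℝ) : ℂ)
  have hc : ‖c‖ = ‖v‖⁻¹ := by simp [c]
  have h' : (c • v, c • w) ∈ T.graph := T.graph.smul_mem c h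
  obtain ⟨y, hy, hw⟩ := (LinearPMap.mem_graph_iff _).1 h'
  have hle : ‖T y‖ₑ ≤ opENorm T :=
    le_iSup₂_of_le (f := fun (v : T.domain) (_ : ‖(v : X)‖ ≤ 1) => ‖T v‖ₑ) y
      (by rw [hy]; simp [norm_smul, hc, hn]) le_rfl
  have := ENNReal.toReal_mono hT hle
  rw [hw, toReal_enorm, norm_smul, hc] at this
  rwa [inv_mul_le_iff₀ (by positivity), mul_comm] at this

/-- If the commutator of a closed operator with a bounded operator is relatively bounded on a
dense set, then it is so on the whole domain. -/
theorem exists_mem_graph_of_dense [CompleteSpace X] {A : X →ₗ.[ℂ] X} (hA : A.IsClosed) {z : ℂ}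
    {R M : X →L[ℂ] X} (hR : IsResolvent A z R)
    (hd : Dense ((prod (commutator A (ofBounded M)) (shift A z).inverse).domain : Set X))
    (hb : opENorm (prod (commutator A (ofBounded M)) (shift A z).inverse) ≠ ⊤)
    {u f : X} (hu : (u, f) ∈ A.graph) :
    ∃ g, (M u, g) ∈ A.graph ∧ ‖g - M f‖ ≤
      (opENorm (prod (commutator A (ofBounded M)) (shift A z).inverse)).toReal * ‖f - z • u‖ := by
  set T := prod (commutator A (ofBounded M)) (shift A z).inverse
  obtain ⟨hR₁, hR₂⟩ := isResolvent_iff.1 hR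
  set v := f - z • u with hv
  obtain ⟨x, hx, hxv⟩ := mem_closure_iff_seq_limit.1 (hd v)
  have hw (j : ℕ) : ∃ w, (x j, w) ∈ T.graph := LinearPMap.mem_domain_iff.1 (hx j)
  choose w hw using hw
  have hwc : CauchySeq w := by
    refine cauchySeq_of_norm_sub_le hxv.cauchySeq (opENorm T).toReal fun j l => ?_
    exact norm_le_opENorm hb (T.graph.sub_mem (hw j) (hw l))
  obtain ⟨w₀, hw₀⟩ := cauchySeq_tendsto_of_complete hwc
  -- The second coordinate is `A M R x_j`, written as commutator plus `M A R x_j`. Both terms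
  -- converge, so closedness of `A` puts `M u` in its domain.
  have hlim : Tendsto (fun j => (M (R (x j)), w j + M (x j + z • R (x j)))) atTop
      (𝓝 (M (R v), w₀ + M (v + z • R v))) := by
    have h₁ : Tendsto (fun j => R (x j)) atTop (𝓝 (R v)) := (R.continuous.tendsto v).comp hxv
    have h₂ (y : X) : Tendsto M (𝓝 y) (𝓝 (M y)) := M.continuous.tendsto y
    exact ((h₂ _).comp h₁).prodMk_nhds
      (hw₀.add ((h₂ _).comp (hxv.add (h₁.const_smul z))))
  have hmem (j : ℕ) : (M (R (x j)), w j + M (x j + z • R (x j))) ∈ A.graph := by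
    obtain ⟨f', g, hf', hg, h⟩ :=
      mem_graph_commutator_ofBounded.1 ((mem_graph_prod_inverse_shift hR).1 (hw j))
    rw [A.mem_graph_snd_inj hf' (hR₁ (x j)) rfl] at h
    rw [h, sub_add_cancel]
    exact hg
  have hRv : R v = u := hR₂ u f hu
  have hvf : v + z • u = f := by simp [hv]
  rw [hRv, hvf] at hlim
  refine ⟨_, hA.mem_of_tendsto hlim (Eventually.of_forall hmem), ?_⟩
  rw [add_sub_cancel_right]
  exact le_of_tendsto_of_tendsto' hw₀.norm (hxv.norm.const_mul _)
    fun j => norm_le_opENorm hb (hw j)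

end Graph

/-! ### Eigenspaces and generalised eigenspaces. -/

section Eigenspace

variable {X : Type*} [NormedAddCommGroup X] [InnerProductSpace ℂ X] {A : X →ₗ.[ℂ] X}

variable (A) in
/-- The eigenspace `ker (A - z)`, as a subspace of the ambient space. -/
def eigenspace (z : ℂ) : Submodule ℂ X where
  carrier := {u | (u, z • u) ∈ A.graph}
  add_mem' {a b} ha hb := by
    have := A.graph.add_mem ha hb
    rwa [Prod.mk_add_mk, ← smul_add] at this
  zero_mem' := by
    rw [Set.mem_ofPred_eq, smul_zero]
    exact A.graph.zero_mem
  smul_mem' c a ha := by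
    have := A.graph.smul_mem c ha
    rwa [Prod.smul_mk, smul_comm] at this

theorem mem_eigenspace {z : ℂ} {u : X} : u ∈ eigenspace A z ↔ (u, z • u) ∈ A.graph := Iff.rfl

theorem mem_kerPow_succ {z : ℂ} {k : ℕ} {u : X} :
    u ∈ kerPow A z (k + 1) ↔ ∃ f ∈ kerPow A z k, (u, f + z • u) ∈ A.graph := by
  simp only [← mem_graph_shift]
  constructor
  · rintro ⟨y, hy, rfl⟩
    exact ⟨_, hy, (shift A z).mem_graph y⟩
  · rintro ⟨f, hf, h⟩
    obtain ⟨y, rfl, rfl⟩ := (LinearPMap.mem_graph_iff _).1 h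
    exact ⟨y, hf, rfl⟩

theorem eigenspace_le_algEigenspace (z : ℂ) : eigenspace A z ≤ algEigenspace A z := by
  refine le_trans (fun u hu => ?_) (le_iSup (kerPow A z) 1)
  exact mem_kerPow_succ.2 ⟨0, Submodule.zero_mem _, by rw [zero_add]; exact hu⟩

/-- Pythagoras: if `A n = z n` and `A v = g`, the left side is `‖(A - y)(n + v)‖²`, so lower bounds
can be proved on `N` and `Nᗮ` separately. -/
theorem norm_sub_smul_sq {N : Submodule ℂ X} {n v g : X} (hn : n ∈ N) (hv : v ∈ Nᗮ)
    (hg : g ∈ Nᗮ) (z y : ℂ) :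
    ‖(z • n + g) - y • (n + v)‖ ^ 2 = ‖z - y‖ ^ 2 * ‖n‖ ^ 2 + ‖g - y • v‖ ^ 2 := by
  have h : (z • n + g) - y • (n + v) = (z - y) • n + (g - y • v) := by
    rw [sub_smul, smul_add]; abel
  have h0 : inner ℂ ((z - y) • n) (g - y • v) = 0 :=
    (Submodule.mem_orthogonal _ _).1 (Nᗮ.sub_mem hg (Nᗮ.smul_mem y hv)) _ (N.smul_mem _ hn)
  rw [h, sq, norm_add_sq_eq_norm_sq_add_norm_sq_of_inner_eq_zero _ _ h0, norm_smul]
  ring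

theorem exists_smul_norm_eq_one {z : ℂ} {u f : X} {ε : ℝ} (h : ‖f - z • u‖ < ε * ‖u‖) :
    ∃ c : ℂ, ‖c • u‖ = 1 ∧ ‖c • f - z • c • u‖ < ε := by
  have hu : ‖u‖ ≠ 0 := by
    intro h0
    rw [h0, mul_zero] at h
    exact absurd h (norm_nonneg _).not_gt
  refine ⟨((‖u‖⁻¹ : ℝ) : ℂ), by simp [norm_smul, hu], ?_⟩
  rw [smul_comm z, ← smul_sub, norm_smul, Complex.norm_real, norm_inv, norm_norm,
    inv_mul_lt_iff₀ (by positivity), mul_comm]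
  exact h

end Eigenspace

/-! ### Self-adjoint operators: resolvent criteria and discrete spectrum. -/

section SelfAdjoint

variable {X : Type*} [NormedAddCommGroup X] [InnerProductSpace ℂ X] [CompleteSpace X]
  {A : X →ₗ.[ℂ] X}

theorem inner_eq_of_isSelfAdjoint (hA : IsSelfAdjoint A) {u f v g : X} (hu : (u, f) ∈ A.graph)
    (hv : (v, g) ∈ A.graph) : inner ℂ f v = inner ℂ u g := by
  have h := LinearPMap.adjoint_isFormalAdjoint hA.dense_domain
  rw [LinearPMap.isSelfAdjoint_def.1 hA] at h
  obtain ⟨y, rfl, rfl⟩ := (LinearPMap.mem_graph_iff _).1 hu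
  obtain ⟨y', rfl, rfl⟩ := (LinearPMap.mem_graph_iff _).1 hv
  exact h y y'

/-- The inclusion of the adjoint in `A`, which is the part of self-adjointness beyond symmetry. -/
theorem mem_graph_of_forall_inner_eq (hA : IsSelfAdjoint A) {u f : X}
    (h : ∀ v g, (v, g) ∈ A.graph → inner ℂ f v = inner ℂ u g) : (u, f) ∈ A.graph := by
  have hd := hA.dense_domain
  have h' : ∀ x : A.domain, inner ℂ f (x : X) = inner ℂ u (A x) := fun x => h _ _ (A.mem_graph x)
  have hu := LinearPMap.mem_adjoint_domain_of_exists u ⟨f, h'⟩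
  have he := LinearPMap.adjoint_apply_eq hd ⟨u, hu⟩ h'
  have hm := A.adjoint.mem_graph ⟨u, hu⟩
  rw [he] at hm
  have hgr := congrArg LinearPMap.graph (LinearPMap.isSelfAdjoint_def.1 hA)
  exact hgr ▸ hm

/-- If `A - z` and `A - conj z` are bounded below, then `z` is in the resolvent set. -/
theorem mem_resolventSet_of_le_norm (hA : IsSelfAdjoint A) {z : ℂ} {c : ℝ} (hc : 0 < c)
    (h₁ : ∀ u f, (u, f) ∈ A.graph → c * ‖u‖ ≤ ‖f - z • u‖)
    (h₂ : ∀ u f, (u, f) ∈ A.graph → c * ‖u‖ ≤ ‖f - star z • u‖) :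
    z ∈ resolventSet A := by
  set S : Submodule ℂ X := LinearMap.range (shift A z).toFun
  have hmem (v : X) : v ∈ S ↔ ∃ u, (u, v + z • u) ∈ A.graph := by
    simp only [← mem_graph_shift]
    constructor
    · rintro ⟨y, rfl⟩
      exact ⟨y, (shift A z).mem_graph y⟩
    · rintro ⟨u, hu⟩
      obtain ⟨y, -, hy⟩ := (LinearPMap.mem_graph_iff _).1 hu
      exact ⟨y, hy⟩
  have hclosed : IsClosed (S : Set X) := by
    refine IsSeqClosed.isClosed fun x v hx hxv => ?_
    have hx' (j : ℕ) := (hmem (x j)).1 (hx j)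
    choose u hu using hx'
    have huc : CauchySeq u := by
      refine cauchySeq_of_norm_sub_le hxv.cauchySeq c⁻¹ fun j l => ?_
      have := h₁ _ _ (A.graph.sub_mem (hu j) (hu l))
      rw [le_inv_mul_iff₀ hc]
      refine this.trans_eq (congrArg _ ?_)
      simp only [smul_sub]
      abel
    obtain ⟨u₀, hu₀⟩ := cauchySeq_tendsto_of_complete huc
    refine (hmem v).2 ⟨u₀, hA.isClosed.mem_of_tendsto
      (hu₀.prodMk_nhds (hxv.add (hu₀.const_smul z))) (Eventually.of_forall hu)⟩
  have horth : Sᗮ = ⊥ := by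
    refine (Submodule.eq_bot_iff _).2 fun y hy => ?_
    -- A vector orthogonal to the range of `A - z` is an eigenvector at `star z`, which `h₂`
    -- excludes.
    have hg : (y, star z • y) ∈ A.graph := by
      refine mem_graph_of_forall_inner_eq hA fun v g hv => ?_
      have := (Submodule.mem_orthogonal' _ _).1 hy (g - z • v) ((hmem _).2 ⟨v, by simpa using hv⟩)
      rw [inner_sub_right, inner_smul_right, sub_eq_zero] at this
      rw [inner_smul_left, this]
      simp
    have := h₂ _ _ hg
    rw [sub_self, norm_zero] at this
    exact norm_le_zero_iff.1 (nonpos_of_mul_nonpos_right this hc)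
  have htop : S = ⊤ := by
    have : CompleteSpace S := hclosed.completeSpace_coe
    exact (Submodule.orthogonal_eq_bot_iff).1 horth
  have hbij : Function.Bijective (shift A z).toFun := by
    refine ⟨LinearMap.ker_eq_bot.1 (ker_shift_eq_bot_iff.2 fun u hu => ?_),
      LinearMap.range_eq_top.1 htop⟩
    have := h₁ _ _ hu
    rw [sub_self, norm_zero] at this
    exact norm_le_zero_iff.1 (nonpos_of_mul_nonpos_right this hc)
  let e := LinearEquiv.ofBijective (shift A z).toFun hbij
  have he (v : X) : ((e.symm v : X), v + z • (e.symm v : X)) ∈ A.graph := by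
    have := (shift A z).mem_graph (e.symm v)
    have hv : (shift A z) (e.symm v) = v := e.apply_symm_apply v
    rwa [hv, mem_graph_shift] at this
  let R : X →L[ℂ] X := ((shift A z).domain.subtype ∘ₗ e.symm.toLinearMap).mkContinuous c⁻¹ (by
    intro v
    rw [le_inv_mul_iff₀ hc]
    simpa using h₁ _ _ (he v))
  refine ⟨R, isResolvent_iff.2 ⟨he, fun u f hu => ?_⟩⟩
  have hu' : (u, f - z • u) ∈ (shift A z).graph := by
    rw [mem_graph_shift, sub_add_cancel]; exact hu
  obtain ⟨y, hy, hf⟩ := (LinearPMap.mem_graph_iff _).1 hu'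
  have : e.symm (f - z • u) = y := by
    rw [LinearEquiv.symm_apply_eq]
    exact hf.symm
  calc R (f - z • u) = (e.symm (f - z • u) : X) := rfl
    _ = u := by rw [this]; exact hy

/-- Since `⟨u, A u⟩` is real, `⟨u, (A - z) u⟩` has imaginary part `-(im z) ‖u‖²`; Cauchy–Schwarz
concludes. -/
theorem abs_im_mul_norm_le (hA : IsSelfAdjoint A) (z : ℂ) {u f : X} (hu : (u, f) ∈ A.graph) :
    |z.im| * ‖u‖ ≤ ‖f - z • u‖ := by
  rcases eq_or_ne u 0 with rfl | hu0
  · simp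
  have him : (inner ℂ u f).im = 0 := by
    have h := inner_eq_of_isSelfAdjoint hA hu hu
    rw [← inner_conj_symm] at h
    exact Complex.conj_eq_iff_im.1 h
  have h₁ : (inner ℂ u (f - z • u)).im = -(z.im * ‖u‖ ^ 2) := by
    have hre : (inner ℂ u u).re = ‖u‖ ^ 2 := inner_self_eq_norm_sq (𝕜 := ℂ) u
    have him' : (inner ℂ u u).im = 0 := inner_self_im (𝕜 := ℂ) u
    rw [inner_sub_right, inner_smul_right, Complex.sub_im, him, Complex.mul_im, hre, him']
    ring
  have h₂ := (Complex.abs_im_le_norm (inner ℂ u (f - z • u))).trans (norm_inner_le_norm _ _)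
  rw [h₁, abs_neg, abs_mul, abs_of_nonneg (sq_nonneg ‖u‖)] at h₂
  have : 0 < ‖u‖ := norm_pos_iff.2 hu0
  nlinarith

theorem mem_resolventSet_of_im_ne_zero (hA : IsSelfAdjoint A) {z : ℂ} (hz : z.im ≠ 0) :
    z ∈ resolventSet A :=
  mem_resolventSet_of_le_norm hA (abs_pos.2 hz) (fun _ _ => abs_im_mul_norm_le hA z)
    fun u f hu => by simpa using abs_im_mul_norm_le hA (star z) hu

theorem isClosed_eigenspace (hA : IsSelfAdjoint A) (z : ℂ) :
    IsClosed (eigenspace A z : Set X) :=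
  hA.isClosed.preimage (f := fun u => (u, z • u)) (by fun_prop)

/-- For a self-adjoint operator and a real number, the algebraic and the geometric eigenspaces
agree. -/
theorem algEigenspace_eq (hA : IsSelfAdjoint A) {z : ℂ} (hz : z.im = 0) :
    algEigenspace A z = eigenspace A z := by
  refine le_antisymm (iSup_le fun k => ?_) (eigenspace_le_algEigenspace z)
  have hz' : star z = z := Complex.conj_eq_iff_im.2 hz
  induction k with
  | zero => exact bot_le
  | succ k ih =>
    intro u hu
    obtain ⟨f, hf, hu⟩ := mem_kerPow_succ.1 hu
    -- With `(A - z) u = f` and `(A - z) f = 0`, symmetry gives `‖f‖² = ⟨u, (A - z) f⟩ = 0`.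
    have h := inner_eq_of_isSelfAdjoint hA hu (ih hf)
    have hs : (starRingEnd ℂ) z = z := hz'
    rw [inner_add_left, inner_smul_left, inner_smul_right, hs, add_eq_right,
      inner_self_eq_zero] at h
    rw [h, zero_add] at hu
    exact hu

/-- The orthogonal projection to an eigenspace reduces the operator. -/
theorem exists_orthogonal_decomposition (hA : IsSelfAdjoint A) (z : ℂ)
    {u f : X} (hu : (u, f) ∈ A.graph) :
    ∃ n ∈ eigenspace A z, ∃ v ∈ (eigenspace A z)ᗮ, ∃ g ∈ (eigenspace A z)ᗮ,
      (v, g) ∈ A.graph ∧ u = n + v ∧ f = z • n + g := by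
  have : CompleteSpace (eigenspace A z) := (isClosed_eigenspace hA z).completeSpace_coe
  obtain ⟨n, hn, v, hv, rfl⟩ := (eigenspace A z).exists_add_mem_mem_orthogonal u
  have hvg : (v, f - z • n) ∈ A.graph := by
    simpa using A.graph.sub_mem hu hn
  refine ⟨n, hn, v, hv, f - z • n, ?_, hvg, rfl, by simp⟩
  rw [Submodule.mem_orthogonal] at hv ⊢
  intro m hm
  rw [← inner_eq_of_isSelfAdjoint hA hm hvg, inner_smul_left, hv m hm, mul_zero]

/-- If `A - z`, with `z` real, is bounded below on the orthogonal complement of its kernel, then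
a punctured neighbourhood of `z` is in the resolvent set. -/
theorem mem_resolventSet_of_near (hA : IsSelfAdjoint A) {z : ℂ} (hz : z.im = 0) {c : ℝ}
    (h : ∀ u f, (u, f) ∈ A.graph → u ∈ (eigenspace A z)ᗮ → c * ‖u‖ ≤ ‖f - z • u‖)
    {y : ℂ} (hy : ‖z - y‖ < c) (hn : eigenspace A z = ⊥ ∨ y ≠ z) : y ∈ resolventSet A := by
  -- Stated for all `y'` at the same distance from `z`, so that it also covers `star y`, as `z` is
  -- real.
  have key : ∃ b > 0, ∀ y', ‖z - y'‖ = ‖z - y‖ → ∀ u f, (u, f) ∈ A.graph →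
      b * ‖u‖ ≤ ‖f - y' • u‖ := by
    -- `A - y` is multiplication by `z - y` on the eigenspace and is bounded below by `c - ‖z - y‖`
    -- on its complement.
    have hb : ∃ b > 0, b ≤ c - ‖z - y‖ ∧ ∀ n ∈ eigenspace A z, b * ‖n‖ ≤ ‖z - y‖ * ‖n‖ := by
      rcases hn with hn | hn
      · refine ⟨_, sub_pos.2 hy, le_rfl, fun n h => ?_⟩
        rw [hn, Submodule.mem_bot] at h
        simp [h]
      · have : 0 < ‖z - y‖ := norm_pos_iff.2 (sub_ne_zero.2 hn.symm)
        exact ⟨min (c - ‖z - y‖) ‖z - y‖, lt_min (sub_pos.2 hy) this, min_le_left _ _,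
          fun n _ => by gcongr; exact min_le_right _ _⟩
    obtain ⟨b, hb0, hb, hbn⟩ := hb
    refine ⟨b, hb0, fun y' hy' u f hu => ?_⟩
    obtain ⟨n, hn, v, hv, g, hg, hvg, rfl, rfl⟩ := exists_orthogonal_decomposition hA z hu
    refine le_of_sq_le_sq ?_ (norm_nonneg _)
    rw [norm_sub_smul_sq hn hv hg]
    have h0 : inner ℂ n v = 0 := (Submodule.mem_orthogonal _ _).1 hv _ hn
    have h₁ : b * ‖v‖ ≤ ‖g - y' • v‖ := by
      have e : g - z • v = (g - y' • v) - (z - y') • v := by rw [sub_smul]; abel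
      have := (h v g hvg hv).trans (e ▸ norm_sub_le (g - y' • v) ((z - y') • v))
      rw [norm_smul, hy'] at this
      nlinarith [norm_nonneg v]
    have h₂ := hbn n hn
    rw [mul_pow, sq ‖n + v‖, norm_add_sq_eq_norm_sq_add_norm_sq_of_inner_eq_zero _ _ h0, hy',
      ← mul_pow]
    have h₁' := pow_le_pow_left₀ (by positivity) h₁ 2
    have h₂' := pow_le_pow_left₀ (by positivity) h₂ 2
    nlinarith
  obtain ⟨b, hb, h'⟩ := key
  refine mem_resolventSet_of_le_norm hA hb (h' y rfl) (h' _ ?_)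
  have hz' : star z = z := Complex.conj_eq_iff_im.2 hz
  rw [← norm_star (z - y), star_sub, hz']

theorem mem_eigenspace_of_tendsto (hA : IsSelfAdjoint A) {z : ℂ} {u f : ℕ → X} {x : X}
    (hu : ∀ j, (u j, f j) ∈ A.graph) (hx : Tendsto u atTop (𝓝 x))
    (hf : Tendsto (fun j => f j - z • u j) atTop (𝓝 0)) : x ∈ eigenspace A z := by
  have hf' : Tendsto f atTop (𝓝 (z • x)) := by
    simpa using hf.add (hx.const_smul z)
  exact hA.isClosed.mem_of_tendsto (hx.prodMk_nhds hf') (Eventually.of_forall hu)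

/-- If bounded approximate eigenvectors at `z` have convergent subsequences, then `z` is in the
resolvent set or in the discrete spectrum. -/
theorem mem_discreteSpectrum (hA : IsSelfAdjoint A) {z : ℂ} (hz : z ∈ spectrum A)
    (h : ∀ u f : ℕ → X, (∀ j, (u j, f j) ∈ A.graph) → (∀ j, ‖u j‖ ≤ 1) →
      Tendsto (fun j => f j - z • u j) atTop (𝓝 0) →
      ∃ (x : X) (ψ : ℕ → ℕ), StrictMono ψ ∧ Tendsto (u ∘ ψ) atTop (𝓝 x)) :
    z ∈ discreteSpectrum A := by
  have hre : z.im = 0 := by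
    by_contra hne
    exact hz (mem_resolventSet_of_im_ne_zero hA hne)
  -- Otherwise unit approximate eigenvectors in the complement would subconverge to a unit vector
  -- both in the eigenspace and orthogonal to it.
  have hbound : ∃ c > 0, ∀ u f, (u, f) ∈ A.graph → u ∈ (eigenspace A z)ᗮ →
      c * ‖u‖ ≤ ‖f - z • u‖ := by
    by_contra! hcon
    have hcon' (j : ℕ) : ∃ u f, (u, f) ∈ A.graph ∧ u ∈ (eigenspace A z)ᗮ ∧ ‖u‖ = 1 ∧
        ‖f - z • u‖ ≤ 1 / ((j : ℝ) + 1) := by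
      obtain ⟨u, f, hu, huN, hlt⟩ := hcon (1 / ((j : ℝ) + 1)) (by positivity)
      obtain ⟨c, hc₁, hc₂⟩ := exists_smul_norm_eq_one hlt
      exact ⟨c • u, c • f, A.graph.smul_mem c hu, Submodule.smul_mem _ c huN, hc₁, hc₂.le⟩
    choose u f hu huN hu1 hlim using hcon'
    have hlim' := squeeze_zero_norm hlim tendsto_one_div_add_atTop_nhds_zero_nat
    obtain ⟨x, ψ, hψ, hx⟩ := h u f hu (fun j => (hu1 j).le) hlim'
    have hxN : x ∈ eigenspace A z := mem_eigenspace_of_tendsto hA (fun j => hu (ψ j)) hx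
      (hlim'.comp hψ.tendsto_atTop)
    have hxN' : x ∈ (eigenspace A z)ᗮ :=
      (Submodule.isClosed_orthogonal _).mem_of_tendsto hx (Eventually.of_forall fun j => huN _)
    have hx1 : ‖x‖ = 1 := tendsto_nhds_unique hx.norm (by simp [hu1])
    have := (Submodule.mem_orthogonal _ _).1 hxN' x hxN
    rw [inner_self_eq_zero] at this
    simp [this] at hx1
  obtain ⟨c, hc, hbound⟩ := hbound
  have hres (y : ℂ) := mem_resolventSet_of_near hA hre hbound (y := y)
  have hne : eigenspace A z ≠ ⊥ := fun h0 => hz (hres z (by simpa using hc) (Or.inl h0))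
  refine ⟨hz, ?_, ?_, Metric.ball z c, Metric.ball_mem_nhds z hc, ?_⟩
  · obtain ⟨u, hu, hu0⟩ := Submodule.exists_mem_ne_zero_of_ne_bot hne
    obtain ⟨y, hy, hAy⟩ := (LinearPMap.mem_graph_iff _).1 (mem_eigenspace.1 hu)
    refine ⟨y, fun h0 => hu0 ?_, ?_⟩
    · exact hy.symm.trans (by rw [h0]; rfl)
    · exact hAy.trans (congrArg _ hy.symm)
  -- Riesz: any sequence in the unit ball of the eigenspace is a sequence of approximate
  -- eigenvectors, so the ball is compact.
  · rw [algEigenspace_eq hA hre]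
    refine FiniteDimensional.of_isCompact_closedBall₀ ℂ (r := 1) one_pos
      (IsSeqCompact.isCompact fun u hu => ?_)
    have hu' (j : ℕ) : ‖(u j : X)‖ ≤ 1 := by simpa using hu j
    obtain ⟨x, ψ, hψ, hx⟩ := h (fun j => u j) (fun j => z • (u j : X)) (fun j => (u j).2) hu'
      (by simp)
    have hxN : x ∈ eigenspace A z :=
      (isClosed_eigenspace hA z).mem_of_tendsto hx (Eventually.of_forall fun j => (u (ψ j)).2)
    refine ⟨⟨x, hxN⟩, ?_, ψ, hψ, tendsto_subtype_rng.2 hx⟩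
    simpa using le_of_tendsto' hx.norm fun j => hu' _
  · ext y
    simp only [Set.mem_inter_iff, Set.mem_singleton_iff]
    constructor
    · rintro ⟨hyc, hy⟩
      by_contra hyz
      rw [Metric.mem_ball', dist_eq_norm] at hyc
      exact hy (hres y hyc (Or.inr hyz))
    · rintro rfl
      exact ⟨Metric.mem_ball_self hc, hz⟩

end SelfAdjoint

/-! ### Spectral mapping for the resolvent. -/

section Resolvent

variable {X : Type*} [NormedAddCommGroup X] [InnerProductSpace ℂ X] {A : X →ₗ.[ℂ] X}

/-- The spectral mapping for the resolvent. -/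
theorem notMem_spectrum_resolvent {μ s : ℝ} {R : X →L[ℂ] X} (hR : IsResolvent A μ R)
    (hs : s ≠ 0) (h : ((μ + s⁻¹ : ℝ) : ℂ) ∈ resolventSet A) : s ∉ _root_.spectrum ℝ R := by
  obtain ⟨S, hS⟩ := h
  obtain ⟨hR₁, hR₂⟩ := isResolvent_iff.1 hR
  obtain ⟨hS₁, hS₂⟩ := isResolvent_iff.1 hS
  have hs' : (s : ℂ) ≠ 0 := Complex.ofReal_ne_zero.2 hs
  rw [_root_.spectrum.notMem_iff]
  have h₁ (v : X) : R v - S v + (s : ℂ)⁻¹ • R (S v) = 0 := by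
    have := hR₂ _ _ (hS₁ v)
    push_cast at this
    rw [add_smul, add_sub_assoc, add_sub_cancel_left, map_add, map_smul] at this
    rw [← sub_eq_zero.2 this]; abel
  have h₂ (v : X) : S v - R v - (s : ℂ)⁻¹ • S (R v) = 0 := by
    have := hS₂ _ _ (hR₁ v)
    push_cast at this
    rw [add_smul, sub_add_eq_sub_sub, add_sub_cancel_right, map_sub, map_smul] at this
    rw [← sub_eq_zero.2 this]; abel
  set D : X →L[ℂ] X := (s : ℂ) • ContinuousLinearMap.id ℂ X - R
  set E : X →L[ℂ] X := (s : ℂ)⁻¹ • (ContinuousLinearMap.id ℂ X + (s : ℂ)⁻¹ • S)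
  have hD : algebraMap ℝ (X →L[ℂ] X) s - R = D := by
    ext x
    simp [D, Algebra.algebraMap_eq_smul_one]
  rw [hD]
  refine ⟨⟨D, E, ?_, ?_⟩, rfl⟩
  -- The inverse of `s - R` is `s⁻¹ (1 + s⁻¹ S)`; the two resolvent identities `h₁`, `h₂` verify the
  -- two sides.
  · ext v
    have e : D (E v) = v - (s : ℂ)⁻¹ • (R v - S v + (s : ℂ)⁻¹ • R (S v)) := by
      simp only [D, E, _root_.sub_apply, _root_.smul_apply, _root_.add_apply,
        ContinuousLinearMap.id_apply, map_smul, map_add]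
      match_scalars <;> field_simp
    exact e.trans (by rw [h₁ v, smul_zero, sub_zero]; rfl)
  · ext v
    have e : E (D v) = v + (s : ℂ)⁻¹ • (S v - R v - (s : ℂ)⁻¹ • S (R v)) := by
      simp only [D, E, _root_.sub_apply, _root_.smul_apply, _root_.add_apply,
        ContinuousLinearMap.id_apply, map_smul, map_sub]
      match_scalars <;> field_simp
    exact e.trans (by rw [h₂ v, smul_zero, add_zero]; rfl)

end Resolvent

/-! ### Isolated spectral points and lower bounds. -/

section Isolated

variable {X : Type*} [NormedAddCommGroup X] [InnerProductSpace ℂ X] [CompleteSpace X]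

/-- A point which is isolated in the spectrum of a bounded self-adjoint operator `a`: the operator
`a - w` is bounded below on the orthogonal complement of its kernel. -/
theorem exists_norm_le_of_isolated {a : X →L[ℂ] X} (ha : IsSelfAdjoint a) {w : ℝ}
    (hw : ∀ᶠ s in 𝓝[≠] w, s ∉ _root_.spectrum ℝ a) :
    ∃ C ≥ (0 : ℝ), ∀ u ∈ (a - (w : ℂ) • ContinuousLinearMap.id ℂ X).kerᗮ,
      ‖u‖ ≤ C * ‖a u - (w : ℂ) • u‖ := by
  set b : X →L[ℂ] X := a - (w : ℂ) • ContinuousLinearMap.id ℂ X with hb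
  -- Both functions are continuous on the spectrum because `w` is isolated. `f(a)` maps into the
  -- kernel of `a - w`, and `g(a)` inverts `a - w` modulo `f(a)`.
  set f : ℝ → ℝ := fun s => if s = w then 1 else 0
  set g : ℝ → ℝ := fun s => (s - w)⁻¹
  have hloc : ∀ᶠ s in 𝓝[_root_.spectrum ℝ a] w, s = w := by
    rw [eventually_nhdsWithin_iff] at hw ⊢
    filter_upwards [hw] with s hs hsa
    by_contra h
    exact hs h hsa
  have hfc : ContinuousOn f (_root_.spectrum ℝ a) := by
    intro s hs
    rcases eq_or_ne s w with rfl | hsw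
    · refine tendsto_const_nhds.congr' ?_
      filter_upwards [hloc] with t ht
      rw [ht]
    · refine ContinuousAt.continuousWithinAt ?_
      refine (continuousAt_const (y := (0 : ℝ))).congr ?_
      filter_upwards [isOpen_ne.mem_nhds hsw] with t ht
      exact (if_neg ht).symm
  have hgc : ContinuousOn g (_root_.spectrum ℝ a) := by
    intro s hs
    rcases eq_or_ne s w with rfl | hsw
    · refine tendsto_const_nhds.congr' ?_
      filter_upwards [hloc] with t ht
      rw [ht]
    · exact ((continuousAt_id.sub continuousAt_const).inv₀ (sub_ne_zero.2 hsw)).continuousWithinAt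
  have hbc : b = cfc (fun s : ℝ => s - w) a := by
    rw [cfc_sub (fun s : ℝ => s) (fun _ => w) a, cfc_id' ℝ a, cfc_const w a, hb]
    congr 1
  have hbP : b * cfc f a = 0 := by
    rw [hbc, ← cfc_mul (fun s : ℝ => s - w) f a]
    refine (cfc_congr fun s _ => ?_).trans (cfc_zero ℝ a)
    by_cases h : s = w <;> simp [f, h]
  have hgb : cfc g a * b + cfc f a = 1 := by
    rw [hbc, ← cfc_mul g (fun s : ℝ => s - w) a,
      ← cfc_add a (fun s => g s * (s - w)) f, ← cfc_one ℝ a]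
    refine cfc_congr fun s _ => ?_
    by_cases h : s = w
    · simp [f, g, h]
    · simp [f, g, h, sub_ne_zero.2 h]
  have hP : IsSelfAdjoint (cfc f a) := cfc_predicate f a
  refine ⟨‖cfc g a‖, norm_nonneg _, fun u hu => ?_⟩
  have hker (x : X) : cfc f a x ∈ b.ker := by
    rw [LinearMap.mem_ker]
    exact congrArg (fun T : X →L[ℂ] X => T x) hbP
  have h0 : cfc f a u = 0 := by
    have := (Submodule.mem_orthogonal _ _).1 hu _ (hker (cfc f a u))
    rw [← inner_self_eq_zero (𝕜 := ℂ)]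
    have hs := (ContinuousLinearMap.isSelfAdjoint_iff_isSymmetric.1 hP) (cfc f a u) u
    exact hs.symm.trans this
  have h1 : cfc g a (b u) + cfc f a u = u := congrArg (fun T : X →L[ℂ] X => T u) hgb
  rw [h0, add_zero] at h1
  calc ‖u‖ = ‖cfc g a (b u)‖ := by rw [h1]
    _ ≤ _ := (cfc g a).le_opNorm _

variable {A : X →ₗ.[ℂ] X}

theorem isSelfAdjoint_resolvent (hA : IsSelfAdjoint A) {μ : ℝ} {R : X →L[ℂ] X}
    (hR : IsResolvent A μ R) : IsSelfAdjoint R := by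
  obtain ⟨h₁, -⟩ := isResolvent_iff.1 hR
  rw [ContinuousLinearMap.isSelfAdjoint_iff_isSymmetric]
  intro x y
  have h := inner_eq_of_isSelfAdjoint hA (h₁ x) (h₁ y)
  rw [inner_add_left, inner_add_right, inner_smul_left, inner_smul_right, Complex.conj_ofReal,
    add_left_inj] at h
  exact h.symm

theorem im_eq_zero_of_mem_spectrum (hA : IsSelfAdjoint A) {z : ℂ} (hz : z ∈ spectrum A) :
    z.im = 0 := by
  by_contra hne
  exact hz (mem_resolventSet_of_im_ne_zero hA hne)

/-- At an isolated point of the spectrum, a self-adjoint operator is bounded below on the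
orthogonal complement of the eigenspace. -/
theorem exists_norm_le_of_isolated_spectrum (hA : IsSelfAdjoint A) {z : ℂ}
    (hz : z ∈ spectrum A) {U : Set ℂ} (hU : U ∈ 𝓝 z) (hUz : U ∩ spectrum A = {z}) :
    ∃ C ≥ (0 : ℝ), ∀ u f, (u, f) ∈ A.graph → u ∈ (eigenspace A z)ᗮ → ‖u‖ ≤ C * ‖f - z • u‖ := by
  obtain ⟨x, rfl⟩ : ∃ x : ℝ, z = x := ⟨z.re, by
    apply Complex.ext <;> simp [im_eq_zero_of_mem_spectrum hA hz]⟩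
  have hres : ∀ᶠ y : ℝ in 𝓝 x, y ≠ x → (y : ℂ) ∈ resolventSet A := by
    filter_upwards [Complex.continuous_ofReal.continuousAt.eventually hU] with y hy hyx
    by_contra h
    have : (y : ℂ) ∈ ({(x : ℂ)} : Set ℂ) := hUz ▸ ⟨hy, h⟩
    exact hyx (Complex.ofReal_injective this)
  -- A real base point makes the resolvent a bounded self-adjoint operator.
  obtain ⟨μ, hμ, hμx⟩ : ∃ μ : ℝ, (μ : ℂ) ∈ resolventSet A ∧ μ ≠ x :=
    (((eventually_nhdsWithin_iff (s := {x}ᶜ)).2 hres).and self_mem_nhdsWithin).exists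
  obtain ⟨R, hR⟩ := hμ
  obtain ⟨hR₁, hR₂⟩ := isResolvent_iff.1 hR
  have hxμ : x - μ ≠ 0 := sub_ne_zero.2 hμx.symm
  -- The image of `x` under `t ↦ (t - μ)⁻¹`; isolation of `x` transfers to `w`.
  set w : ℝ := (x - μ)⁻¹ with hw
  have hw0 : w ≠ 0 := inv_ne_zero hxμ
  have hwC : (w : ℂ) ≠ 0 := Complex.ofReal_ne_zero.2 hw0
  have hxw : (x : ℂ) = μ + (w : ℂ)⁻¹ := by simp [hw]
  have hiso : ∀ᶠ s in 𝓝[≠] w, s ∉ _root_.spectrum ℝ R := by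
    have ht : Tendsto (fun s : ℝ => μ + s⁻¹) (𝓝 w) (𝓝 x) := by
      have := (tendsto_inv₀ hw0).const_add μ
      rwa [hw, inv_inv, add_sub_cancel] at this
    rw [eventually_nhdsWithin_iff]
    filter_upwards [ht.eventually hres, isOpen_ne.mem_nhds hw0] with s hs hs0 hsw
    refine notMem_spectrum_resolvent hR hs0 (hs fun h => hsw ?_)
    rw [Set.mem_singleton_iff, hw, ← h, add_sub_cancel_left, inv_inv]
  obtain ⟨C, hC0, hC⟩ := exists_norm_le_of_isolated (isSelfAdjoint_resolvent hA hR) hiso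
  have hker : (R - (w : ℂ) • ContinuousLinearMap.id ℂ X).ker ≤ eigenspace A x := by
    intro p hp
    have hp' : R p = (w : ℂ) • p := sub_eq_zero.1 hp
    have h := A.graph.smul_mem (w : ℂ)⁻¹ (hR₁ p)
    rw [hp', Prod.smul_mk, inv_smul_smul₀ hwC, smul_add, smul_comm, inv_smul_smul₀ hwC,
      add_comm, ← add_smul, ← hxw] at h
    exact h
  refine ⟨C * (|w| * ‖R‖), by positivity, fun u f hu huN => ?_⟩
  have h := hC u (Submodule.orthogonal_le hker huN)
  have e : R u - (w : ℂ) • u = -((w : ℂ) • R (f - (x : ℂ) • u)) := by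
    have h₂ := hR₂ u f hu
    have : f - (x : ℂ) • u = (f - (μ : ℂ) • u) - (w : ℂ)⁻¹ • u := by
      rw [hxw, add_smul]; abel
    rw [this, map_sub, map_smul, h₂, smul_sub, smul_inv_smul₀ hwC, neg_sub]
  rw [e, norm_neg, norm_smul, Complex.norm_real, Real.norm_eq_abs] at h
  refine h.trans ?_
  rw [mul_assoc, mul_assoc]
  gcongr
  exact R.le_opNorm _

/-- There is no weakly null sequence of approximate eigenvectors at a point of the discrete
spectrum. -/
theorem not_tendsto_of_mem_discreteSpectrum (hA : IsSelfAdjoint A) {z : ℂ}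
    (hz : z ∈ discreteSpectrum A) {u f : ℕ → X} (hu : ∀ j, (u j, f j) ∈ A.graph)
    (hu1 : ∀ j, ‖u j‖ = 1) (hweak : ∀ y, Tendsto (fun j => inner ℂ y (u j)) atTop (𝓝 0)) :
    ¬ Tendsto (fun j => f j - z • u j) atTop (𝓝 0) := by
  intro hlim
  obtain ⟨hzA, -, hfin, U, hU, hUz⟩ := hz
  obtain ⟨C, hC0, hC⟩ := exists_norm_le_of_isolated_spectrum hA hzA hU hUz
  rw [algEigenspace_eq hA (im_eq_zero_of_mem_spectrum hA hzA)] at hfin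
  have hdec (j : ℕ) := exists_orthogonal_decomposition hA z (hu j)
  choose n hn v hv g hg hvg hnv hfg using hdec
  have hvlim : Tendsto v atTop (𝓝 0) := by
    refine squeeze_zero_norm (fun j => ?_) (by simpa using hlim.norm.const_mul C)
    have e : f j - z • u j = g j - z • v j := by
      rw [hfg, hnv, smul_add]; abel
    exact e ▸ hC _ _ (hvg j) (hv j)
  -- In finite dimension weak convergence is norm convergence: the coordinates of `n j` are inner
  -- products with `u j`.
  have hnlim : Tendsto n atTop (𝓝 0) := by
    let b := stdOrthonormalBasis ℂ (eigenspace A z)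
    have hsum (j : ℕ) : ∑ i, inner ℂ (b i : X) (u j) • (b i : X) = n j := by
      have h := congrArg Subtype.val (b.sum_repr' ⟨n j, hn j⟩)
      rw [AddSubmonoidClass.coe_finsetSum] at h
      refine Eq.trans (Finset.sum_congr rfl fun i _ => ?_) h
      rw [hnv, inner_add_right, (Submodule.mem_orthogonal _ _).1 (hv j) _ (b i).2, add_zero]
      rfl
    have := tendsto_finsetSum Finset.univ
      fun i (_ : i ∈ Finset.univ) => (hweak (b i : X)).smul_const (b i : X)
    simpa [hsum] using this
  have := hnlim.add hvlim
  simp only [← hnv, add_zero] at this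
  have := this.norm
  simp [hu1] at this

end Isolated

/-! ### Supports in `L²`, and Zhislin points are essential. -/

section L2

variable {d : ℕ}

/-- A locally null set is null, by second countability. -/
theorem ae_eq_zero_of_disjoint_essSupport {u : L2 d} {s : Set (EuclideanSpace ℝ (Fin d))}
    (hs : Disjoint s (essSupport u)) : ∀ᵐ x, x ∈ s → u x = 0 := by
  have : volume (s ∩ {x | u x ≠ 0}) = 0 := by
    refine measure_null_of_locally_null _ fun x hx => ?_
    have hx' := Set.disjoint_left.1 hs hx.1
    simp only [essSupport, Set.mem_ofPred_eq, not_forall, not_not] at hx'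
    obtain ⟨U, hU, h⟩ := hx'
    obtain ⟨V, hVU, hVo, hxV⟩ := mem_nhds_iff.1 hU
    have h' := ae_restrict_of_ae_restrict_of_subset hVU h
    rw [ae_restrict_iff' hVo.measurableSet] at h'
    refine ⟨V ∩ (s ∩ {x | u x ≠ 0}), inter_mem (mem_nhdsWithin_of_mem_nhds (hVo.mem_nhds hxV)) self_mem_nhdsWithin, ?_⟩
    refine measure_mono_null ?_ h'
    rintro y ⟨hyV, -, hy⟩ h
    exact hy (h hyV)
  refine measure_mono_null ?_ this
  intro x hx
  simpa using hx

/-- Approximate `y` by a compactly supported function, whose pairing with `u k` vanishes for large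
`k`. -/
theorem tendsto_inner_of_essSupport_subset {u : ℕ → L2 d} (hu1 : ∀ k, ‖u k‖ = 1)
    (hu : ∀ k : ℕ, essSupport (u k) ⊆ (Metric.closedBall 0 (k : ℝ))ᶜ) (y : L2 d) :
    Tendsto (fun k => inner ℂ y (u k)) atTop (𝓝 0) := by
  rw [Metric.tendsto_atTop]
  intro ε hε
  obtain ⟨g, hg, hgy, hgc, hgL⟩ := (Lp.memLp y).exists_hasCompactSupport_eLpNorm_sub_le
    (p := 2) (by simp) (ε := ENNReal.ofReal (ε / 2)) (by simpa using hε)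
  set G : L2 d := hgL.toLp g with hG
  have hyG : ‖y - G‖ ≤ ε / 2 := by
    rw [Lp.norm_def]
    refine ENNReal.toReal_le_of_le_ofReal (by positivity) (le_trans (le_of_eq ?_) hgy)
    refine eLpNorm_congr_ae ?_
    filter_upwards [Lp.coeFn_sub y G, hgL.coeFn_toLp] with x h₁ h₂
    rw [h₁, Pi.sub_apply, Pi.sub_apply, h₂]
  obtain ⟨r, hr⟩ := hg.isCompact.isBounded.subset_closedBall 0
  obtain ⟨N, hN⟩ := exists_nat_ge r
  refine ⟨N, fun k hk => ?_⟩
  have hzero : inner ℂ G (u k) = 0 := by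
    rw [L2.inner_def]
    refine integral_eq_zero_of_ae ?_
    have hd : Disjoint (Metric.closedBall 0 (k : ℝ)) (essSupport (u k)) :=
      (Set.disjoint_compl_right_iff_subset.2 subset_rfl).mono_right (hu k)
    filter_upwards [ae_eq_zero_of_disjoint_essSupport hd, hgL.coeFn_toLp] with x h₁ h₂
    by_cases hx : x ∈ Metric.closedBall (0 : EuclideanSpace ℝ (Fin d)) k
    · simp [h₁ hx]
    · have : g x = 0 := by
        refine image_eq_zero_of_notMem_tsupport fun hx' => hx ?_
        exact Metric.closedBall_subset_closedBall (hN.trans (Nat.cast_le.2 hk)) (hr hx')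
      simp [hG, h₂, this]
  rw [dist_zero_right]
  have : inner ℂ y (u k) = inner ℂ (y - G) (u k) := by rw [inner_sub_left, hzero, sub_zero]
  rw [this]
  calc ‖inner ℂ (y - G) (u k)‖ ≤ ‖y - G‖ * ‖u k‖ := norm_inner_le_norm _ _
    _ ≤ ε / 2 := by rw [hu1, mul_one]; exact hyG
    _ < ε := half_lt_self hε

theorem zhislinSpectrum_subset {A : L2 d →ₗ.[ℂ] L2 d} (hA : IsSelfAdjoint A) :
    zhislinSpectrum A ⊆ essentialSpectrum A := by
  rintro z ⟨u, hu⟩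
  refine ⟨?_, fun hz => ?_⟩
  · rintro ⟨R, hR⟩
    obtain ⟨-, hR₂⟩ := isResolvent_iff.1 hR
    have h := (tendsto_zero_iff_norm_tendsto_zero.2 hu.tendsto_zero)
    have h' := (R.continuous.tendsto _).comp h
    simp only [Function.comp_def, hR₂ _ _ (A.mem_graph _), map_zero] at h'
    have := h'.norm
    simp [hu.norm_eq_one] at this
  · refine not_tendsto_of_mem_discreteSpectrum hA hz (fun k => A.mem_graph (u k)) hu.norm_eq_one
      (tendsto_inner_of_essSupport_subset hu.norm_eq_one hu.support_subset)
      (tendsto_zero_iff_norm_tendsto_zero.2 hu.tendsto_zero)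

theorem essSupport_smul_subset (c : ℂ) (u : L2 d) : essSupport (c • u) ⊆ essSupport u := by
  intro x hx U hU h
  refine hx U hU ?_
  filter_upwards [h, ae_restrict_of_ae (Lp.coeFn_smul c u)] with y h₁ h₂
  rw [h₂, Pi.smul_apply, h₁, smul_zero]

/-- Off the Zhislin spectrum, `A - z` is bounded below on functions supported far out. -/
theorem exists_le_norm_of_notMem_zhislinSpectrum {A : L2 d →ₗ.[ℂ] L2 d} {z : ℂ}
    (hz : z ∉ zhislinSpectrum A) :
    ∃ k : ℕ, ∃ δ > 0, ∀ u f, (u, f) ∈ A.graph → essSupport u ⊆ (Metric.closedBall 0 (k : ℝ))ᶜ →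
      δ * ‖u‖ ≤ ‖f - z • u‖ := by
  by_contra! hcon
  have h (k : ℕ) : ∃ u : A.domain, ‖(u : L2 d)‖ = 1 ∧
      essSupport (u : L2 d) ⊆ (Metric.closedBall 0 (k : ℝ))ᶜ ∧
      ‖A u - z • (u : L2 d)‖ < 1 / ((k : ℝ) + 1) := by
    obtain ⟨u, f, hu, hs, hlt⟩ := hcon k (1 / ((k : ℝ) + 1)) (by positivity)
    obtain ⟨c, hc₁, hc₂⟩ := exists_smul_norm_eq_one hlt
    obtain ⟨y, hy, hf⟩ := (LinearPMap.mem_graph_iff _).1 (A.graph.smul_mem c hu)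
    have hy : (y : L2 d) = c • u := hy
    have hf : A y = c • f := hf
    refine ⟨y, ?_, ?_, ?_⟩
    · rw [hy, hc₁]
    · rw [hy]; exact (essSupport_smul_subset c u).trans hs
    · rw [hy, hf]; exact hc₂
  choose u h₁ h₂ h₃ using h
  refine hz ⟨u, h₁, h₂, squeeze_zero (fun _ => norm_nonneg _) (fun k => (h₃ k).le)
    tendsto_one_div_add_atTop_nhds_zero_nat⟩

/-! ### Cutoffs, local compactness, and essential points are Zhislin points. -/

variable {φ : EuclideanSpace ℝ (Fin d) → ℝ}

/-- Multiplication by `φ_n`, as a bounded operator. -/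
noncomputable def cutoffCLM (hφ : IsCutoff φ) (n : ℕ) : L2 d →L[ℂ] L2 d :=
  mulOp (fun x => ((φ ((n : ℝ)⁻¹ • x) : ℝ) : ℂ)) (hφ.memLp n)

/-- Strictness of `k < n` matters: `φ_n = 1` on the open ball of radius `n`, which is a
neighbourhood of each point of the closed ball of radius `k`. -/
theorem essSupport_sub_cutoff_subset (hφ : IsCutoff φ) {k n : ℕ} (hkn : k < n) (u : L2 d) :
    essSupport (u - cutoffCLM hφ n u) ⊆ (Metric.closedBall 0 (k : ℝ))ᶜ := by
  have hn : (0 : ℝ) < n := Nat.cast_pos.2 (k.zero_le.trans_lt hkn)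
  intro x hx hxk
  have hxn : x ∈ Metric.ball (0 : EuclideanSpace ℝ (Fin d)) n :=
    Metric.closedBall_subset_ball (Nat.cast_lt.2 hkn) hxk
  refine hx _ (Metric.isOpen_ball.mem_nhds hxn) ?_
  rw [ae_restrict_iff' measurableSet_ball]
  filter_upwards [Lp.coeFn_sub u (cutoffCLM hφ n u), mulOp_apply _ (hφ.memLp n) u] with y h₁ h₂ hy
  have hy' : φ ((n : ℝ)⁻¹ • y) = 1 := by
    refine hφ.eq_one _ ?_
    rw [mem_ball_zero_iff] at hy ⊢
    rwa [norm_smul, norm_inv, Real.norm_natCast, inv_mul_lt_iff₀ hn, mul_one]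
  rw [h₁, Pi.sub_apply, cutoffCLM, h₂, hy']
  simp

/-- `n = 0` is excluded because `0⁻¹ = 0` makes `φ_0` the constant `φ 0 = 1`. -/
theorem cutoffCLM_comp_indicator (hφ : IsCutoff φ) {n : ℕ} (hn : n ≠ 0) :
    cutoffCLM hφ n ∘L mulOp _ (memLp_indicator
      (measurableSet_closedBall (x := (0 : EuclideanSpace ℝ (Fin d))) (ε := 2 * n))) =
    cutoffCLM hφ n := by
  have hn : (0 : ℝ) < n := Nat.cast_pos.2 (Nat.pos_of_ne_zero hn)
  ext1 u
  refine Lp.ext ?_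
  rw [ContinuousLinearMap.comp_apply, cutoffCLM]
  filter_upwards [mulOp_apply _ (hφ.memLp n) (mulOp _ (memLp_indicator
    (measurableSet_closedBall (x := (0 : EuclideanSpace ℝ (Fin d))) (ε := 2 * n))) u),
    mulOp_apply _ (hφ.memLp n) u, mulOp_apply _ (memLp_indicator
    (measurableSet_closedBall (x := (0 : EuclideanSpace ℝ (Fin d))) (ε := 2 * n))) u]
    with x h₁ h₂ h₃
  rw [h₁, h₂, h₃]
  by_cases hx : x ∈ Metric.closedBall (0 : EuclideanSpace ℝ (Fin d)) (2 * n)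
  · rw [Set.indicator_of_mem hx, one_mul]
  · have : φ ((n : ℝ)⁻¹ • x) = 0 := by
      refine image_eq_zero_of_notMem_tsupport fun h => hx ?_
      have := hφ.tsupport_subset h
      rw [mem_closedBall_zero_iff] at this ⊢
      rwa [norm_smul, norm_inv, Real.norm_natCast, inv_mul_le_iff₀ hn, mul_comm] at this
    simp [this]

theorem isCompactOperator_cutoff_comp_resolvent {A : L2 d →ₗ.[ℂ] L2 d}
    (hcomp : IsLocallyCompact A) (hφ : IsCutoff φ) {n : ℕ} (hn : n ≠ 0) {z : ℂ}
    {R : L2 d →L[ℂ] L2 d} (hR : IsResolvent A z R) :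
    IsCompactOperator (cutoffCLM hφ n ∘L R) := by
  obtain ⟨y, S, hS, hc⟩ := hcomp (Metric.closedBall 0 (2 * n)) measurableSet_closedBall
    Metric.isBounded_closedBall
  -- The resolvent identity moves compactness from the point `y` given by the hypothesis to `z`.
  have hRS : R = S ∘L (ContinuousLinearMap.id ℂ _ + (z - y) • R) := by
    ext1 v
    have h := (isResolvent_iff.1 hS).2 _ _ ((isResolvent_iff.1 hR).1 v)
    rw [add_sub_assoc, ← sub_smul] at h
    exact h.symm
  have := (hc.comp_clm (ContinuousLinearMap.id ℂ _ + (z - y) • R)).clm_comp (cutoffCLM hφ n)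
  rw [← cutoffCLM_comp_indicator hφ hn, hRS]
  exact this

theorem essentialSpectrum_subset {A : L2 d →ₗ.[ℂ] L2 d} (hA : IsSelfAdjoint A)
    (hcomp : IsLocallyCompact A) (hφ : IsCutoff φ)
    (hdense : ∀ᶠ n : ℕ in atTop, Dense ((commutatorResolvent A hφ n).domain : Set (L2 d)))
    (hlim : Tendsto (fun n : ℕ => opENorm (commutatorResolvent A hφ n)) atTop (𝓝 0)) :
    essentialSpectrum A ⊆ zhislinSpectrum A := by
  rintro z ⟨hz, hzd⟩
  by_contra hzZ
  obtain ⟨k, δ, hδ, hfar⟩ := exists_le_norm_of_notMem_zhislinSpectrum hzZ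
  obtain ⟨R, hR⟩ : Complex.I ∈ resolventSet A :=
    mem_resolventSet_of_im_ne_zero hA (by simp)
  -- Chosen so that `η ‖z - i‖ ≤ δ / 2`: the commutator error is absorbed by the far-out lower
  -- bound.
  set η : ℝ := δ / (2 * (‖z - Complex.I‖ + 1)) with hη
  have hη0 : 0 < η := by positivity
  have hsmall : ∀ᶠ n : ℕ in atTop, opENorm (commutatorResolvent A hφ n) < ENNReal.ofReal η :=
    hlim.eventually_lt_const (by simpa using hη0)
  obtain ⟨n, hnd, hns, hkn⟩ := (hdense.and (hsmall.and (eventually_gt_atTop k))).exists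
  set M := cutoffCLM hφ n
  have hcommut : ∀ u f, (u, f) ∈ A.graph → ∃ g, (M u, g) ∈ A.graph ∧
      ‖g - M f‖ ≤ η * ‖f - Complex.I • u‖ := by
    intro u f hu
    obtain ⟨g, hg, hle⟩ := exists_mem_graph_of_dense hA.isClosed hR (M := M) hnd
      hns.ne_top hu
    refine ⟨g, hg, hle.trans ?_⟩
    gcongr
    exact ENNReal.toReal_le_of_le_ofReal hη0.le hns.le
  have hK := isCompactOperator_cutoff_comp_resolvent hcomp hφ (n := n) (by omega) hR
  have hest : ∃ C, ∀ u f, (u, f) ∈ A.graph → ‖u‖ ≤ 2 * ‖M u‖ + C * ‖f - z • u‖ := by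
    refine ⟨2 * (δ⁻¹ * (1 + ‖M‖ + η)), fun u f hu => ?_⟩
    obtain ⟨g, hg, hgle⟩ := hcommut u f hu
    have h₁ := hfar _ _ (A.graph.sub_mem hu hg) (essSupport_sub_cutoff_subset hφ hkn u)
    have e : f - g - z • (u - M u) = (f - z • u) - M (f - z • u) - (g - M f) := by
      rw [map_sub, map_smul, smul_sub]; abel
    have h₂ : ‖f - Complex.I • u‖ ≤ ‖f - z • u‖ + ‖z - Complex.I‖ * ‖u‖ := by
      have : f - Complex.I • u = (f - z • u) + (z - Complex.I) • u := by rw [sub_smul]; abel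
      rw [this, ← norm_smul]
      exact norm_add_le _ _
    have h₃ : ‖f - g - z • (u - M u)‖ ≤ ‖f - z • u‖ + ‖M‖ * ‖f - z • u‖ + ‖g - M f‖ := by
      rw [e]
      refine (norm_sub_le _ _).trans (add_le_add_left ((norm_sub_le _ _).trans ?_) _)
      exact add_le_add_right (M.le_opNorm _) _
    have h₄ : ‖u‖ ≤ ‖M u‖ + ‖u - M u‖ := by
      simpa using norm_add_le (M u) (u - M u)
    have h₅ : η * (‖z - Complex.I‖ * ‖u‖) ≤ δ / 2 * ‖u‖ := by
      rw [← mul_assoc]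
      gcongr
      rw [hη, div_mul_eq_mul_div, div_le_div_iff₀ (by positivity) (by positivity)]
      nlinarith [norm_nonneg (z - Complex.I)]
    have h₆ : δ * ‖u - M u‖ ≤ (1 + ‖M‖ + η) * ‖f - z • u‖ + δ / 2 * ‖u‖ := by
      nlinarith
    have h₇ : ‖u - M u‖ ≤ δ⁻¹ * (1 + ‖M‖ + η) * ‖f - z • u‖ + ‖u‖ / 2 := by
      rw [← mul_le_mul_iff_right₀ hδ]
      refine h₆.trans_eq ?_
      field_simp
    linarith
  obtain ⟨C, hC⟩ := hest
  refine hzd (mem_discreteSpectrum hA hz fun u f hu hu1 hfu => ?_)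
  set v : ℕ → L2 d := fun j => f j - Complex.I • u j with hv
  have hRv (j : ℕ) : R (v j) = u j := (isResolvent_iff.1 hR).2 _ _ (hu j)
  obtain ⟨B, hB⟩ := hfu.norm.bddAbove_range
  have hvB (j : ℕ) : v j ∈ Metric.closedBall (0 : L2 d) (B + ‖z - Complex.I‖) := by
    rw [mem_closedBall_zero_iff]
    have e : v j = (f j - z • u j) + (z - Complex.I) • u j := by
      simp only [hv, sub_smul]; abel
    rw [e]
    refine (norm_add_le _ _).trans (add_le_add (hB ⟨j, rfl⟩) ?_)
    rw [norm_smul]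
    exact mul_le_of_le_one_right (norm_nonneg _) (hu1 j)
  -- `M u_j = (M R) v_j` with `M R` compact and `v_j` bounded.
  obtain ⟨y, -, ψ, hψ, hy⟩ :=
    (hK.isCompact_closure_image_closedBall (B + ‖z - Complex.I‖)).tendsto_subseq
      (x := fun j => M (u j)) fun j => subset_closure ⟨v j, hvB j, by
        rw [← hRv j]; rfl⟩
  have hcauchy : CauchySeq (u ∘ ψ) := by
    -- By `hC`, differences of the `u_j` are controlled by those of the pairs `(M u_j, (A - z)
    -- u_j)`.
    have hpair := (hy.prodMk_nhds (hfu.comp hψ.tendsto_atTop)).cauchySeq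
    refine cauchySeq_of_norm_sub_le hpair (2 + |C|) fun j l => ?_
    have h := hC _ _ (A.graph.sub_mem (hu (ψ j)) (hu (ψ l)))
    refine h.trans ?_
    rw [add_mul]
    gcongr
    · rw [map_sub]
      exact norm_fst_le (((fun j => M (u j)) ∘ ψ) j - ((fun j => M (u j)) ∘ ψ) l,
        ((fun j => f j - z • u j) ∘ ψ) j - ((fun j => f j - z • u j) ∘ ψ) l)
    · exact le_abs_self C
    · refine le_trans (le_of_eq (congrArg norm ?_))
        (norm_snd_le (((fun j => M (u j)) ∘ ψ) j - ((fun j => M (u j)) ∘ ψ) l,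
        ((fun j => f j - z • u j) ∘ ψ) j - ((fun j => f j - z • u j) ∘ ψ) l))
      simp only [Function.comp_apply, smul_sub]
      abel
  obtain ⟨x, hx⟩ := cauchySeq_tendsto_of_complete hcauchy
  exact ⟨x, ψ, hψ, hx⟩

end L2

end Zhislin

theorem theorem2 {d : ℕ}
    (A : Zhislin.L2 d →ₗ.[ℂ] Zhislin.L2 d)
    (hA : IsSelfAdjoint A)
    (hcomp : Zhislin.IsLocallyCompact A)
    (φ : EuclideanSpace ℝ (Fin d) → ℝ)
    (hφ : Zhislin.IsCutoff φ)
    (hdense : ∀ᶠ n : ℕ in atTop,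
      Dense ((Zhislin.commutatorResolvent A hφ n).domain : Set (Zhislin.L2 d)))
    (hlim : Tendsto (fun n : ℕ => Zhislin.opENorm (Zhislin.commutatorResolvent A hφ n))
      atTop (𝓝 0)) :
    Zhislin.essentialSpectrum A = Zhislin.zhislinSpectrum A :=
  Set.Subset.antisymm (Zhislin.essentialSpectrum_subset hA hcomp hφ hdense hlim)
    (Zhislin.zhislinSpectrum_subset hA)
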